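/- Let $d\ge 1$ be an integer and $\alpha\in(0,2)$. Let $(\cdot,\cdot)$ and $|\cdot|$ be the inner product and the norm of $\mathbb{R}^d$, and for $z\in\mathbb{C}^d$, $\nu\in\mathbb{R}^d$ write $(z,\nu)=\sum_{j=1}^d z_j\nu_j$. For $\varkappa>-d$ and $x\in\mathbb{R}^d$ put $$N(\varkappa,x)=\frac{1}{(2\pi)^d}\int_{\mathbb{R}^d}\lambda\,|\lambda|^{\varkappa-1}\exp\{i(x,\lambda)-|\lambda|^\alpha\}\,\mathrm{d}\lambda\in\mathbb{C}^d .$$ If $\varkappa>1-\min(d,2)$ is a real number that is not an odd integer, then for every unit vector $\nu\in\mathbb{R}^d$ $$(N(\varkappa,x),\nu)\sim i\,\frac{2^{\varkappa}}{\pi^{\frac d2+1}}\,\Gamma\left(\frac{\varkappa+1}{2}\right)\Gamma\left(\frac{d+\varkappa+1}{2}\right)\cos\frac{\varkappa\pi}{2}\;\frac{(x,\nu)}{|x|^{d+\varkappa+1}},\qquad |x|\to+\infty .$$ Here $f\sim g$ as $|x|\to+\infty$ means $f(x)-g(x)=o(g(x))$, that is, for every $\varepsilon>0$ there is $R$ such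 that $|f(x)-g(x)|\le\varepsilon|g(x)|$ whenever $|x|\ge R$ (in particular $f(x)=0$ wherever $g(x)=0$ and $|x|$ is large). -/

import Mathlib

open scoped Asymptotics

noncomputable section

/-- A real vector, regarded as a vector with complex coordinates. -/
def complexify {d : ℕ} (v : EuclideanSpace ℝ (Fin d)) : EuclideanSpace ℂ (Fin d) :=
  WithLp.toLp 2 (fun j => ((v j : ℝ) : ℂ))

/-- The pairing of a complex vector with a real vector, complex linear in the former:
the sum of the products of the coordinates. -/
def pairing {d : ℕ} (z : EuclideanSpace ℂ (Fin d)) (v : EuclideanSpace ℝ (Fin d)) : ℂ :=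
  ∑ j, z j * ((v j : ℝ) : ℂ)

/-- The vector-valued function
`N(κ, x) = (2π)^(-d) ∫ ξ |ξ|^(κ - 1) exp (i (x, ξ) - |ξ|^α) dξ`, the integral being taken over the
Euclidean space of dimension `d` with respect to Lebesgue measure. -/
def fracGradKernel {d : ℕ} (α κ : ℝ) (x : EuclideanSpace ℝ (Fin d)) : EuclideanSpace ℂ (Fin d) :=
  (1 / (2 * (Real.pi : ℂ)) ^ d) •
    ∫ ξ : EuclideanSpace ℝ (Fin d),
      (((‖ξ‖ ^ (κ - 1) : ℝ) : ℂ) *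
        Complex.exp (Complex.I * ((inner ℝ x ξ : ℝ) : ℂ) - ((‖ξ‖ ^ α : ℝ) : ℂ))) • complexify ξ

/-- The constant
`2^κ / π^(d/2 + 1) * Γ((κ + 1)/2) * Γ((d + κ + 1)/2) * cos (κ π / 2)`. -/
def fracGradConst (d : ℕ) (κ : ℝ) : ℝ :=
  (2 : ℝ) ^ κ / Real.pi ^ ((d : ℝ) / 2 + 1) * Real.Gamma ((κ + 1) / 2) *
    Real.Gamma (((d : ℝ) + κ + 1) / 2) * Real.cos (κ * Real.pi / 2)

end

open MeasureTheory Set Filter Topology Real InnerProductSpace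

/-! Substituting ξ = η/|x| turns the pairing into (2π)^(-d) |x|^(-(d+κ)) times the integral of ⟪ν,
η⟫ |η|^(κ-1) exp(-τ|η|^α) e^{i⟪w, η⟫}, with w = x/|x| a unit vector and τ = |x|^(-α) → 0. The
theorem is thus an Abel limit as τ → 0, uniform in w, with an error proportional to |⟪w, ν⟫| so that
it is relative to the claimed main term.

For a Gaussian regulariser exp(-s|η|²) the integral is computable. Differentiating the Gaussian
Fourier transform in the direction ν settles κ = 1, and differentiating in s raises κ by 2. A Gamma
integral for a negative power of |η| then lowers an odd degree to any κ > -d, at the cost of a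
fractional integral in s (`oscIntegral_gaussProfile`). The result is i⟪w, ν⟫ j(s) with j bounded,
continuous up to s = 0, and j(0) given by a Mellin transform (`exists_gaussian_regularization`).

Since 0 < α < 2, exp(-τ r^α) is a limit of Gaussian mixtures ∫ exp(-t r²) dμ_n(t): this is
subordination by a one-sided stable law of index α/2, obtained from normalised Pareto sums
(`exists_measure_tendsto_exp_neg_rpow`). A bound |j(s) - j(0)| ≤ ε + C(1 - e^(-s)) integrates
against μ_n to a Laplace transform at 1, whose limit is e^(-τ). The total error is therefore at most
|⟪w, ν⟫|(ε + Cτ). The reflection formula puts the constant in the stated form. -/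

/-! ### Mellin transforms of the derivatives of u^(-b) exp(-1/(4u)) -/

/-- `flatPow m b` is `(-1) ^ m` times the `m`-th derivative of `u ↦ u ^ (-b) * exp (-1 / (4 u))`
on the positive half-line. -/
noncomputable def flatPow : ℕ → ℝ → ℝ → ℝ
  | 0, b, u => u ^ (-b) * exp (-(1 / (4 * u)))
  | m + 1, b, u => b * flatPow m (b + 1) u - 1 / 4 * flatPow m (b + 2) u

theorem hasDerivAt_flatPow (m : ℕ) (b : ℝ) {u : ℝ} (hu : 0 < u) :
    HasDerivAt (flatPow m b) (-flatPow (m + 1) b u) u := by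
  induction m generalizing b with
  | zero =>
    have h1 : HasDerivAt (fun u : ℝ => u ^ (-b)) (-b * u ^ (-b - 1)) u :=
      hasDerivAt_rpow_const (Or.inl hu.ne')
    have h2 : HasDerivAt (fun u : ℝ => -(1 / (4 * u))) (1 / 4 * (u ^ 2)⁻¹) u := by
      have := ((hasDerivAt_inv hu.ne').const_mul (1 / 4)).neg
      convert! this using 1
      · ext x; simp only [Pi.neg_apply]; rw [one_div, mul_inv]; norm_num
      · ring
    have h3 := h1.mul h2.exp
    refine h3.congr_deriv ?_
    simp only [flatPow]
    rw [show -(b + 1) = -b - 1 by ring, show -(b + 2) = -b - 2 by ring, rpow_sub hu (-b) 2,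
      rpow_two]
    field_simp
    ring
  | succ m ih =>
    refine (((ih (b + 1)).const_mul b).sub ((ih (b + 2)).const_mul (1 / 4))).congr_deriv ?_
    conv_rhs => rw [flatPow]
    ring

/-- The substitution u = 1/y gives a Gamma integral with rate 1/4. -/
theorem integrableOn_and_integral_rpow_mul_flatPow_zero {b γ : ℝ} (h : γ < b) :
    IntegrableOn (fun u => u ^ (γ - 1) * flatPow 0 b u) (Ioi 0) ∧
      ∫ u in Ioi (0 : ℝ), u ^ (γ - 1) * flatPow 0 b u = 4 ^ (b - γ) * Gamma (b - γ) := by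
  have key : EqOn (fun x : ℝ => (|(-1 : ℝ)| * x ^ ((-1 : ℝ) - 1)) •
      ((x ^ (-1 : ℝ)) ^ (b - γ - 1) * exp (-(1 / 4) * (x ^ (-1 : ℝ)) ^ (1 : ℝ))))
      (fun u => u ^ (γ - 1) * flatPow 0 b u) (Ioi 0) := by
    intro x (hx : 0 < x)
    simp only [flatPow, smul_eq_mul, abs_neg, abs_one, one_mul]
    rw [← rpow_mul hx.le, ← mul_assoc, ← mul_assoc, ← rpow_add hx, ← rpow_add hx, rpow_one,
      rpow_neg_one]
    congr 2
    · ring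
    · field_simp
  have hI := integrableOn_rpow_mul_exp_neg_mul_rpow (s := b - γ - 1) (p := 1) (b := 1 / 4)
    (by linarith) one_pos (by norm_num)
  constructor
  · exact ((integrableOn_Ioi_comp_rpow_iff _ (by norm_num : (-1 : ℝ) ≠ 0)).2 hI).congr_fun key
      measurableSet_Ioi
  · rw [← setIntegral_congr_fun measurableSet_Ioi key,
      integral_comp_rpow_Ioi (fun y => y ^ (b - γ - 1) * exp (-(1 / 4) * y ^ (1 : ℝ)))
        (by norm_num : (-1 : ℝ) ≠ 0),
      integral_rpow_mul_exp_neg_mul_rpow one_pos (by linarith) (by norm_num)]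
    rw [one_div, inv_rpow (by norm_num), ← rpow_neg (by norm_num)]
    simp

/-- The product is what m integrations by parts would produce. The recursion gives it without
boundary terms: each step contributes b - (b - γ) = γ, so no sign condition on γ is needed. Negative
γ does occur, for κ > 1. -/
theorem integrableOn_and_integral_rpow_mul_flatPow (m : ℕ) {b γ : ℝ} (h : γ < b) :
    IntegrableOn (fun u => u ^ (γ + m - 1) * flatPow m b u) (Ioi 0) ∧
      ∫ u in Ioi (0 : ℝ), u ^ (γ + m - 1) * flatPow m b u =
        (∏ i ∈ Finset.range m, (γ + i)) * (4 ^ (b - γ) * Gamma (b - γ)) := by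
  induction m generalizing b γ with
  | zero => simpa using integrableOn_and_integral_rpow_mul_flatPow_zero h
  | succ m ih =>
    obtain ⟨i1, e1⟩ := ih (b := b + 1) (γ := γ + 1) (by linarith)
    obtain ⟨i2, e2⟩ := ih (b := b + 2) (γ := γ + 1) (by linarith)
    have key : (fun u => u ^ (γ + (m + 1 : ℕ) - 1) * flatPow (m + 1) b u) = fun u =>
        b * (u ^ (γ + 1 + m - 1) * flatPow m (b + 1) u) -
          1 / 4 * (u ^ (γ + 1 + m - 1) * flatPow m (b + 2) u) := by
      ext u
      rw [flatPow, show γ + (m + 1 : ℕ) - 1 = γ + 1 + m - 1 by push_cast; ring]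
      ring
    rw [key]
    refine ⟨(i1.const_mul b).sub (i2.const_mul _), ?_⟩
    rw [integral_sub (i1.const_mul b) (i2.const_mul _), integral_const_mul, integral_const_mul,
      e1, e2, Finset.prod_range_succ', show b + 1 - (γ + 1) = b - γ by ring,
      show b + 2 - (γ + 1) = b - γ + 1 by ring, Real.Gamma_add_one (by linarith),
      rpow_add_one (by norm_num)]
    have : ∀ i : ℕ, γ + 1 + (i : ℝ) = γ + ((i + 1 : ℕ) : ℝ) := fun i => by push_cast; ring
    simp only [this]
    push_cast
    ring

theorem Gamma_add_natCast {γ : ℝ} (m : ℕ) (h : ∀ i : ℕ, γ + i ≠ 0) :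
    Gamma (γ + m) = (∏ i ∈ Finset.range m, (γ + i)) * Gamma γ := by
  induction m with
  | zero => simp
  | succ m ih =>
    rw [Finset.prod_range_succ, Nat.cast_succ, ← add_assoc, Real.Gamma_add_one (h m), ih]
    ring

/-! ### Integrability of radial weights -/

section radial
variable {E : Type*} [NormedAddCommGroup E] [InnerProductSpace ℝ E] [FiniteDimensional ℝ E]
  [MeasurableSpace E] [BorelSpace E]

theorem integrable_norm_rpow_mul_exp [Nontrivial E] {q p s : ℝ} (hq : -(Module.finrank ℝ E : ℝ) < q)
    (hp : 0 < p) (hs : 0 < s) :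
    Integrable (fun η : E => ‖η‖ ^ q * exp (-(s * ‖η‖ ^ p))) := by
  refine (integrable_fun_norm_addHaar (volume : Measure E)
    (f := fun y => y ^ q * exp (-(s * y ^ p)))).2 ?_
  have h1 : 1 ≤ Module.finrank ℝ E := Module.finrank_pos
  refine (integrableOn_rpow_mul_exp_neg_mul_rpow (s := q + (Module.finrank ℝ E - 1)) (p := p)
    (b := s) (by linarith) hp hs).congr_fun ?_ measurableSet_Ioi
  intro y (hy : 0 < y)
  simp only [smul_eq_mul]
  rw [rpow_add hy, ← Nat.cast_one, ← Nat.cast_sub h1, rpow_natCast, neg_mul]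
  ring

theorem norm_ofReal_mul_cexp_inner (a t : ℝ) :
    ‖(a : ℂ) * Complex.exp (Complex.I * (t : ℂ))‖ = |a| := by
  rw [norm_mul, mul_comm Complex.I, Complex.norm_exp_ofReal_mul_I, mul_one, Complex.norm_real,
    Real.norm_eq_abs]
end radial

theorem abs_inner_mul_norm_rpow_le {E : Type*} [NormedAddCommGroup E] [InnerProductSpace ℝ E]
    (κ : ℝ) (ν η : E) :
    |⟪ν, η⟫_ℝ * ‖η‖ ^ (κ - 1)| ≤ ‖ν‖ * ‖η‖ ^ κ := by
  rcases eq_or_ne η 0 with rfl | h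
  · simp only [inner_zero_right, zero_mul, abs_zero]; positivity
  · have h0 : 0 < ‖η‖ := norm_pos_iff.2 h
    rw [abs_mul, abs_of_nonneg (rpow_nonneg h0.le _)]
    calc _ ≤ ‖ν‖ * ‖η‖ * ‖η‖ ^ (κ - 1) := by gcongr; exact abs_real_inner_le_norm ν η
      _ = _ := by rw [mul_assoc, rpow_sub_one h0.ne']; field_simp

/-! ### Oscillatory integrals with Gaussian profile: odd degrees -/

section oscillatory
variable {E : Type*} [NormedAddCommGroup E] [InnerProductSpace ℝ E]

/-- The integrand `⟪ν, η⟫ ‖η‖ ^ (κ - 1) h(‖η‖) exp (i ⟪w, η⟫)`. -/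
noncomputable def oscIntegrand (κ : ℝ) (w ν : E) (h : ℝ → ℝ) (η : E) : ℂ :=
  ((⟪ν, η⟫_ℝ * ‖η‖ ^ (κ - 1) * h ‖η‖ : ℝ) : ℂ) * Complex.exp (Complex.I * ((⟪w, η⟫_ℝ : ℝ) : ℂ))

theorem norm_oscIntegrand_le (κ : ℝ) (w ν : E) (h : ℝ → ℝ) (η : E) :
    ‖oscIntegrand κ w ν h η‖ ≤ ‖ν‖ * (‖η‖ ^ κ * |h ‖η‖|) := by
  rw [oscIntegrand, norm_ofReal_mul_cexp_inner, abs_mul, ← mul_assoc]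
  gcongr
  exact abs_inner_mul_norm_rpow_le κ ν η

variable [FiniteDimensional ℝ E] [MeasurableSpace E] [BorelSpace E]

theorem measurable_oscIntegrand (κ : ℝ) (w ν : E) {h : ℝ → ℝ} (hh : Measurable h) :
    Measurable (oscIntegrand κ w ν h) := by
  unfold oscIntegrand
  have : Measurable fun η : E => h ‖η‖ := hh.comp measurable_norm
  fun_prop

/-- The oscillatory integral of `⟪ν, η⟫ ‖η‖ ^ (κ - 1) h(‖η‖) exp (i ⟪w, η⟫)`. -/
noncomputable def oscIntegral (κ : ℝ) (w ν : E) (h : ℝ → ℝ) : ℂ :=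
  ∫ η : E, oscIntegrand κ w ν h η

variable [Nontrivial E]

theorem integrable_oscIntegrand {κ p s : ℝ} (hκ : -(Module.finrank ℝ E : ℝ) < κ) (hp : 0 < p)
    (hs : 0 < s) (w ν : E) {h : ℝ → ℝ} (hh : Measurable h)
    (hb : ∀ r, 0 ≤ r → |h r| ≤ exp (-(s * r ^ p))) :
    Integrable (oscIntegrand κ w ν h) := by
  refine ((integrable_norm_rpow_mul_exp (E := E) hκ hp hs).const_mul ‖ν‖).mono'
    (measurable_oscIntegrand κ w ν hh).aestronglyMeasurable (ae_of_all _ fun η => ?_)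
  refine (norm_oscIntegrand_le κ w ν h η).trans ?_
  gcongr
  exact hb _ (norm_nonneg _)

/-- The profile of a Gaussian. -/
noncomputable def gaussProfile (s r : ℝ) : ℝ := exp (-(s * r ^ 2))

theorem measurable_gaussProfile (s : ℝ) : Measurable (gaussProfile s) := by
  unfold gaussProfile; fun_prop

theorem abs_gaussProfile_le {s t : ℝ} (h : s ≤ t) (r : ℝ) :
    |gaussProfile t r| ≤ exp (-(s * r ^ (2 : ℝ))) := by
  rw [gaussProfile, abs_exp, rpow_two]
  gcongr

theorem integrable_oscIntegrand_gaussProfile {κ s : ℝ} (hκ : -(Module.finrank ℝ E : ℝ) < κ)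
    (hs : 0 < s) (w ν : E) : Integrable (oscIntegrand κ w ν (gaussProfile s)) :=
  integrable_oscIntegrand hκ two_pos hs w ν (measurable_gaussProfile s)
    fun r _ => abs_gaussProfile_le le_rfl r

/-- Differentiating the Gaussian in its parameter brings down -|η|², which raises κ by 2. -/
theorem hasDerivAt_oscIntegral_gaussProfile {κ s : ℝ} (hκ : -(Module.finrank ℝ E : ℝ) < κ)
    (hs : 0 < s) (w ν : E) :
    HasDerivAt (fun s => oscIntegral κ w ν (gaussProfile s))
      (-oscIntegral (κ + 2) w ν (gaussProfile s)) s := by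
  have hκ2 : -(Module.finrank ℝ E : ℝ) < κ + 2 := by linarith
  have := (hasDerivAt_integral_of_dominated_loc_of_deriv_le (μ := (volume : Measure E))
    (F := fun s η => oscIntegrand κ w ν (gaussProfile s) η)
    (F' := fun s η => -oscIntegrand (κ + 2) w ν (gaussProfile s) η)
    (bound := fun η => ‖ν‖ * (‖η‖ ^ (κ + 2) * exp (-(s / 2 * ‖η‖ ^ (2 : ℝ)))))
    (x₀ := s) (Ioi_mem_nhds (half_lt_self hs))
    (Eventually.of_forall fun t =>
      (measurable_oscIntegrand κ w ν (measurable_gaussProfile t)).aestronglyMeasurable)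
    (integrable_oscIntegrand_gaussProfile hκ hs w ν)
    (measurable_oscIntegrand (κ + 2) w ν (measurable_gaussProfile s)).neg.aestronglyMeasurable
    (ae_of_all _ fun η t ht => by
      rw [norm_neg]
      refine (norm_oscIntegrand_le (κ + 2) w ν (gaussProfile t) η).trans ?_
      gcongr
      exact abs_gaussProfile_le (le_of_lt ht) _)
    ((integrable_norm_rpow_mul_exp hκ2 two_pos (half_pos hs)).const_mul _)
    (ae_of_all _ fun η t ht => by
      unfold oscIntegrand gaussProfile
      rcases eq_or_ne η 0 with rfl | h
      · simpa using hasDerivAt_const t (0 : ℂ)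
      have h0 : 0 < ‖η‖ := norm_pos_iff.2 h
      have h1 : HasDerivAt (fun t : ℝ => exp (-(t * ‖η‖ ^ 2)))
          (exp (-(t * ‖η‖ ^ 2)) * -(1 * ‖η‖ ^ 2)) t :=
        (((hasDerivAt_id t).mul_const (‖η‖ ^ 2)).neg).exp
      have h2 := ((h1.const_mul (⟪ν, η⟫_ℝ * ‖η‖ ^ (κ - 1))).ofReal_comp).mul_const
        (Complex.exp (Complex.I * ((⟪w, η⟫_ℝ : ℝ) : ℂ)))
      refine h2.congr_deriv ?_
      rw [show κ + 2 - 1 = κ - 1 + 2 by ring, rpow_add h0, rpow_two]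
      push_cast
      ring)).2
  rwa [integral_neg] at this

/-- Both sides come from the derivative at τ = 0 of the Gaussian Fourier transform at w + τν,
computed once under the integral and once from the closed form. -/
theorem oscIntegral_one_gaussProfile {s : ℝ} (hs : 0 < s) {w : E} (hw : ‖w‖ = 1) (ν : E) :
    oscIntegral 1 w ν (gaussProfile s) = (flatPow 0 ((Module.finrank ℝ E : ℝ) / 2 + 1) s : ℂ) *
      (Complex.I * ((⟪w, ν⟫_ℝ * (π ^ ((Module.finrank ℝ E : ℝ) / 2) / 2) : ℝ) : ℂ)) := by
  set n : ℝ := (Module.finrank ℝ E : ℝ) with hn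
  have hn0 : 0 ≤ n := Nat.cast_nonneg _
  have hsc : 0 < (s : ℂ).re := by simpa using hs
  have hsplit : ∀ (τ : ℝ) (v : E), Complex.exp (-(s : ℂ) * ‖v‖ ^ 2
      + Complex.I * ((⟪w + τ • ν, v⟫_ℝ : ℝ) : ℂ)) =
      ((gaussProfile s ‖v‖ : ℝ) : ℂ) * Complex.exp (Complex.I * ((⟪w + τ • ν, v⟫_ℝ : ℝ) : ℂ)) := by
    intro τ v
    rw [Complex.exp_add, gaussProfile]
    push_cast
    rw [neg_mul]
  have hF : ∀ τ : ℝ, ∫ v : E, Complex.exp (-(s : ℂ) * ‖v‖ ^ 2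
      + Complex.I * ((⟪w + τ • ν, v⟫_ℝ : ℝ) : ℂ)) =
      (((π / s) ^ (n / 2) * exp (-(‖w + τ • ν‖ ^ 2 / (4 * s))) : ℝ) : ℂ) := by
    intro τ
    rw [GaussianFourier.integral_cexp_neg_mul_sq_norm_add hsc, Complex.I_sq,
      ← Complex.ofReal_div, show ((Module.finrank ℝ E : ℂ) / 2) = ((n / 2 : ℝ) : ℂ) by simp [hn],
      ← Complex.ofReal_cpow (by positivity)]
    push_cast
    congr 2
    ring
  have hbd : Integrable (fun η : E => ‖ν‖ * (‖η‖ ^ (1 : ℝ) * exp (-(s * ‖η‖ ^ (2 : ℝ))))) :=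
    (integrable_norm_rpow_mul_exp (by linarith) two_pos hs).const_mul _
  have hL := (hasDerivAt_integral_of_dominated_loc_of_deriv_le (μ := (volume : Measure E))
    (F := fun (τ : ℝ) (v : E) => Complex.exp (-(s : ℂ) * ‖v‖ ^ 2
      + Complex.I * ((⟪w + τ • ν, v⟫_ℝ : ℝ) : ℂ)))
    (F' := fun τ v => Complex.I * oscIntegrand 1 (w + τ • ν) ν (gaussProfile s) v)
    (bound := fun η => ‖ν‖ * (‖η‖ ^ (1 : ℝ) * exp (-(s * ‖η‖ ^ (2 : ℝ)))))
    (x₀ := 0) univ_mem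
    (Eventually.of_forall fun t =>
      (GaussianFourier.integrable_cexp_neg_mul_sq_norm_add hsc _ _).aestronglyMeasurable)
    (GaussianFourier.integrable_cexp_neg_mul_sq_norm_add hsc _ _)
    ((measurable_oscIntegrand _ _ _
      (measurable_gaussProfile s)).const_mul _).aestronglyMeasurable
    (ae_of_all _ fun η t _ => by
      rw [norm_mul, Complex.norm_I, one_mul]
      refine (norm_oscIntegrand_le _ _ ν (gaussProfile s) η).trans ?_
      gcongr
      exact abs_gaussProfile_le le_rfl _)
    hbd
    (ae_of_all _ fun η t _ => by
      simp only [hsplit]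
      have h1 : HasDerivAt (fun t : ℝ => ⟪w + t • ν, η⟫_ℝ) ⟪ν, η⟫_ℝ t := by
        simp only [inner_add_left, real_inner_smul_left]
        simpa using ((hasDerivAt_id t).mul_const ⟪ν, η⟫_ℝ).const_add ⟪w, η⟫_ℝ
      refine (((h1.ofReal_comp.const_mul Complex.I).cexp).const_mul _).congr_deriv ?_
      simp only [oscIntegrand, sub_self, rpow_zero]
      push_cast
      ring)).2
  simp only [hF] at hL
  have hN : HasDerivAt (fun τ : ℝ => ‖w + τ • ν‖ ^ 2) (2 * ⟪w, ν⟫_ℝ) 0 := by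
    have h1 : HasDerivAt (fun τ : ℝ => w + τ • ν) ν 0 := by
      simpa using ((hasDerivAt_id (0 : ℝ)).smul_const ν).const_add w
    simpa using h1.norm_sq
  have hR := (((hN.div_const (4 * s)).neg.exp).const_mul ((π / s) ^ (n / 2))).ofReal_comp
  have huniq := hL.unique hR
  rw [integral_const_mul] at huniq
  simp only [Pi.neg_apply, zero_smul, add_zero, hw, one_pow] at huniq
  have : oscIntegral 1 w ν (gaussProfile s) = -Complex.I * (Complex.I *
      ∫ v, oscIntegrand 1 w ν (gaussProfile s) v) := by
    rw [oscIntegral, ← mul_assoc, neg_mul, Complex.I_mul_I]; ring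
  rw [this, huniq, flatPow, neg_add, rpow_add hs, div_rpow pi_pos.le hs.le, rpow_neg hs.le,
    rpow_neg_one]
  push_cast
  field_simp
  ring

theorem oscIntegral_odd_gaussProfile (m : ℕ) {s : ℝ} (hs : 0 < s) {w : E} (hw : ‖w‖ = 1) (ν : E) :
    oscIntegral (2 * m + 1) w ν (gaussProfile s) =
      (flatPow m ((Module.finrank ℝ E : ℝ) / 2 + 1) s : ℂ) *
      (Complex.I * ((⟪w, ν⟫_ℝ * (π ^ ((Module.finrank ℝ E : ℝ) / 2) / 2) : ℝ) : ℂ)) := by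
  induction m generalizing s with
  | zero => simpa using oscIntegral_one_gaussProfile hs hw ν
  | succ m ih =>
    have hm : -(Module.finrank ℝ E : ℝ) < 2 * m + 1 := by
      have : (0 : ℝ) ≤ Module.finrank ℝ E := Nat.cast_nonneg _
      have : (0 : ℝ) ≤ m := Nat.cast_nonneg _
      linarith
    have h1 := hasDerivAt_oscIntegral_gaussProfile hm hs w ν
    have h2 := ((hasDerivAt_flatPow m ((Module.finrank ℝ E : ℝ) / 2 + 1) hs).ofReal_comp).mul_const
      (Complex.I * ((⟪w, ν⟫_ℝ * (π ^ ((Module.finrank ℝ E : ℝ) / 2) / 2) : ℝ) : ℂ))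
    have h3 := h1.unique (h2.congr_of_eventuallyEq
      (eventually_of_mem (Ioi_mem_nhds hs) fun t ht => ih ht))
    rw [show (2 * ((m + 1 : ℕ) : ℝ) + 1) = 2 * m + 1 + 2 by push_cast; ring, ← neg_inj, h3]
    push_cast
    ring
end oscillatory

/-! ### Fractional integration in the Gaussian parameter: general κ -/

/-- The fractional integral `∫ (u - |s|)₊ ^ (β - 1) flatPow m b u du` over the positive half-line. -/
noncomputable def flatFracIntegral (m : ℕ) (b β s : ℝ) : ℝ :=
  ∫ u in Ioi (0 : ℝ), max (u - |s|) 0 ^ (β - 1) * flatPow m b u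

theorem measurable_flatPow (m : ℕ) (b : ℝ) : Measurable (flatPow m b) := by
  induction m generalizing b with
  | zero =>
    change Measurable fun u : ℝ => u ^ (-b) * exp (-(1 / (4 * u)))
    fun_prop
  | succ m ih => exact ((ih (b + 1)).const_mul b).sub ((ih (b + 2)).const_mul _)

theorem norm_max_sub_rpow_mul_le {m : ℕ} {b β : ℝ} (hβ : 1 < β) (s : ℝ) {u : ℝ} (hu : 0 < u) :
    ‖max (u - |s|) 0 ^ (β - 1) * flatPow m b u‖ ≤ ‖u ^ (β - 1) * flatPow m b u‖ := by
  rw [norm_mul, norm_mul]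
  gcongr
  rw [Real.norm_of_nonneg (by positivity), Real.norm_of_nonneg (by positivity)]
  exact rpow_le_rpow (le_max_right _ _)
    (max_le (by linarith [abs_nonneg s]) hu.le) (by linarith)

section
variable {m : ℕ} {b β : ℝ}

/-- The truncation `max` and the absolute value fix the domain of integration and define the
function for all real s. Because β > 1, the s = 0 integrand dominates the others, which yields
continuity at 0 in particular. -/
theorem continuous_flatFracIntegral (hβ : 1 < β)
    (hI : IntegrableOn (fun u => u ^ (β - 1) * flatPow m b u) (Ioi 0)) :
    Continuous (flatFracIntegral m b β) := by
  refine continuous_of_dominated (bound := fun u => ‖u ^ (β - 1) * flatPow m b u‖) (fun s => ?_)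
    (fun s => ?_) hI.norm (ae_of_all _ fun _ => ?_)
  · exact ((by fun_prop : Measurable fun u : ℝ => max (u - |s|) 0 ^ (β - 1)).mul
      (measurable_flatPow m b)).aestronglyMeasurable
  · exact (ae_restrict_mem measurableSet_Ioi).mono fun _ hu => norm_max_sub_rpow_mul_le hβ s hu
  · exact (((continuous_const.sub continuous_abs).max continuous_const).rpow_const
      fun _ => Or.inr (by linarith)).mul continuous_const

theorem abs_flatFracIntegral_le (hβ : 1 < β)
    (hI : IntegrableOn (fun u => u ^ (β - 1) * flatPow m b u) (Ioi 0)) (s : ℝ) :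
    |flatFracIntegral m b β s| ≤ ∫ u in Ioi (0 : ℝ), ‖u ^ (β - 1) * flatPow m b u‖ :=
  norm_integral_le_of_norm_le hI.norm
    ((ae_restrict_mem measurableSet_Ioi).mono fun _ hu => norm_max_sub_rpow_mul_le hβ s hu)

theorem integral_rpow_mul_flatPow_add (hβ : 1 < β) {s : ℝ} (hs : 0 < s) :
    ∫ t in Ioi (0 : ℝ), t ^ (β - 1) * flatPow m b (s + t) = flatFracIntegral m b β s := by
  rw [flatFracIntegral, ← integral_indicator measurableSet_Ioi,
    ← integral_indicator measurableSet_Ioi]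
  conv_rhs => rw [← integral_add_right_eq_self _ s]
  refine integral_congr_ae ?_
  filter_upwards with t
  rw [abs_of_pos hs]
  rcases lt_or_ge 0 t with ht | ht
  · rw [indicator_of_mem (by exact ht), indicator_of_mem (by simp only [mem_Ioi]; linarith),
      add_sub_cancel_right, max_eq_left ht.le, add_comm]
  · rw [indicator_of_notMem (by simpa using ht)]
    by_cases h : t + s ∈ Ioi (0 : ℝ)
    · rw [indicator_of_mem h, add_sub_cancel_right, max_eq_right ht, zero_rpow (by linarith),
        zero_mul]
    · rw [indicator_of_notMem h]
end

section
variable {E : Type*} [NormedAddCommGroup E] [InnerProductSpace ℝ E] [FiniteDimensional ℝ E]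
  [MeasurableSpace E] [BorelSpace E] [Nontrivial E]

/-- Write |η|^(κ-1) = |η|^(2m) |η|^(-2β) and Γ(β)|η|^(-2β) = ∫ t^(β-1) exp(-t|η|²) dt. The new
exponential merges with the Gaussian, replacing s by s + t, so Fubini reduces the claim to degree 2m
+ 1. Absolute integrability is that of the original degree κ integrand. -/
theorem oscIntegral_gaussProfile {κ : ℝ} (hκ : -(Module.finrank ℝ E : ℝ) < κ) (m : ℕ)
    (hm : 1 < (1 - κ) / 2 + m) {s : ℝ} (hs : 0 < s) {w : E} (hw : ‖w‖ = 1) (ν : E) :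
    oscIntegral κ w ν (gaussProfile s) =
      Complex.I * ((⟪w, ν⟫_ℝ * (π ^ ((Module.finrank ℝ E : ℝ) / 2) / 2 /
        Gamma ((1 - κ) / 2 + m) *
        flatFracIntegral m ((Module.finrank ℝ E : ℝ) / 2 + 1) ((1 - κ) / 2 + m) s) : ℝ) : ℂ) := by
  set β : ℝ := (1 - κ) / 2 + m with hβ
  have hG : 0 < Gamma β := Gamma_pos_of_pos (by linarith)
  have hm1 : -(Module.finrank ℝ E : ℝ) < 2 * m + 1 := by
    have : (0 : ℝ) ≤ Module.finrank ℝ E := Nat.cast_nonneg _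
    have : (0 : ℝ) ≤ m := Nat.cast_nonneg _
    linarith
  let f : E → ℝ → ℂ := fun η t => ((t ^ (β - 1) * exp (-(‖η‖ ^ 2 * t)) : ℝ) : ℂ) *
    oscIntegrand (2 * m + 1) w ν (gaussProfile s) η
  have hgamma : ∀ η : E, η ≠ 0 → ∫ t in Ioi (0 : ℝ), t ^ (β - 1) * exp (-(‖η‖ ^ 2 * t)) =
      (1 / ‖η‖ ^ 2) ^ β * Gamma β := fun η hη =>
    integral_rpow_mul_exp_neg_mul_Ioi (by linarith) (by positivity)
  have hgammaI : ∀ η : E, η ≠ 0 →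
      IntegrableOn (fun t => t ^ (β - 1) * exp (-(‖η‖ ^ 2 * t))) (Ioi 0) := fun η hη =>
    .of_integral_ne_zero (by rw [hgamma η hη]; positivity)
  have hshift : ∀ η : E, η ≠ 0 → (((1 / ‖η‖ ^ 2) ^ β : ℝ) : ℂ) *
      oscIntegrand (2 * m + 1) w ν (gaussProfile s) η = oscIntegrand κ w ν (gaussProfile s) η := by
    intro η hη
    have h0 : 0 < ‖η‖ := norm_pos_iff.2 hη
    have h1 : (1 / ‖η‖ ^ 2) ^ β * ‖η‖ ^ ((2 * m + 1 : ℝ) - 1) = ‖η‖ ^ (κ - 1) := by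
      rw [one_div, ← rpow_two, ← rpow_neg h0.le, ← rpow_mul h0.le, ← rpow_add h0]
      congr 1
      rw [hβ]; ring
    rw [oscIntegrand, oscIntegrand, ← h1]
    push_cast
    ring
  have hmeas : Measurable (Function.uncurry f) := by
    have h1 := (measurable_oscIntegrand (2 * m + 1) w ν (measurable_gaussProfile s)).comp
      (measurable_fst : Measurable (Prod.fst : E × ℝ → E))
    have h2 : Measurable fun p : E × ℝ =>
        ((p.2 ^ (β - 1) * exp (-(‖p.1‖ ^ 2 * p.2)) : ℝ) : ℂ) := by fun_prop
    exact h2.mul h1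
  have hne : ∀ᵐ η : E, η ≠ 0 := by simp [ae_iff]
  have hint : Integrable (Function.uncurry f) (volume.prod (volume.restrict (Ioi 0))) := by
    rw [integrable_prod_iff hmeas.aestronglyMeasurable]
    constructor
    · filter_upwards [hne] with η hη
      have h1 : Integrable (fun t : ℝ => ((t ^ (β - 1) * exp (-(‖η‖ ^ 2 * t)) : ℝ) : ℂ))
        (volume.restrict (Ioi 0)) := (hgammaI η hη).integrable.ofReal
      exact h1.mul_const (oscIntegrand (2 * m + 1) w ν (gaussProfile s) η)
    · refine ((integrable_oscIntegrand_gaussProfile hκ hs w ν).norm.const_mul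
        (Gamma β)).congr ?_
      filter_upwards [hne] with η hη
      simp only [Function.uncurry, f, norm_mul]
      rw [integral_mul_const, ← hshift η hη, norm_mul, Complex.norm_real,
        Real.norm_of_nonneg (by positivity)]
      have : ∫ t in Ioi (0 : ℝ), ‖((t ^ (β - 1) * exp (-(‖η‖ ^ 2 * t)) : ℝ) : ℂ)‖ =
          (1 / ‖η‖ ^ 2) ^ β * Gamma β := by
        rw [← hgamma η hη]
        refine setIntegral_congr_fun measurableSet_Ioi fun t (ht : 0 < t) => ?_
        simp only [Complex.norm_real]
        exact Real.norm_of_nonneg (by positivity)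
      rw [this]
      ring
  have hswap := integral_integral_swap hint
  have hleft : ∫ η : E, ∫ t in Ioi (0 : ℝ), f η t =
      (Gamma β : ℂ) * oscIntegral κ w ν (gaussProfile s) := by
    rw [oscIntegral, ← integral_const_mul]
    refine integral_congr_ae ?_
    filter_upwards [hne] with η hη
    simp only [f]
    rw [integral_mul_const, integral_complex_ofReal, hgamma η hη, ← hshift η hη]
    push_cast
    ring
  have hright : ∫ t in Ioi (0 : ℝ), ∫ η : E, f η t =
      ((flatFracIntegral m ((Module.finrank ℝ E : ℝ) / 2 + 1) β s : ℝ) : ℂ) *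
      (Complex.I * ((⟪w, ν⟫_ℝ * (π ^ ((Module.finrank ℝ E : ℝ) / 2) / 2) : ℝ) : ℂ)) := by
    rw [← integral_rpow_mul_flatPow_add hm hs, ← integral_complex_ofReal, ← integral_mul_const]
    refine setIntegral_congr_fun measurableSet_Ioi fun t (ht : 0 < t) => ?_
    have h1 : ∀ η : E, f η t = ((t ^ (β - 1) : ℝ) : ℂ) *
        oscIntegrand (2 * m + 1) w ν (gaussProfile (s + t)) η := by
      intro η
      simp only [f, oscIntegrand, gaussProfile]
      rw [show -((s + t) * ‖η‖ ^ 2) = -(s * ‖η‖ ^ 2) + -(‖η‖ ^ 2 * t) by ring, Real.exp_add]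
      push_cast
      ring
    simp only [h1]
    rw [integral_const_mul]
    have h2 := oscIntegral_odd_gaussProfile m (add_pos hs ht) hw ν
    rw [oscIntegral] at h2
    rw [h2]
    push_cast
    ring
  rw [hleft, hright] at hswap
  have hGc : (Gamma β : ℂ) ≠ 0 := by exact_mod_cast hG.ne'
  refine mul_left_cancel₀ hGc (hswap.trans ?_)
  push_cast
  field_simp

/-- The Gaussian regularisations of the oscillatory integral extend continuously to parameter `0`,
with an explicit value there. -/
theorem exists_gaussian_regularization {κ : ℝ} (hκ : -(Module.finrank ℝ E : ℝ) < κ)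
    (hodd : ∀ i : ℕ, κ ≠ 2 * i + 1) :
    ∃ j : ℝ → ℝ, Continuous j ∧ (∃ B, ∀ s, |j s| ≤ B) ∧
      j 0 = π ^ ((Module.finrank ℝ E : ℝ) / 2) / 2 * 4 ^ ((Module.finrank ℝ E + κ + 1) / 2) *
        Gamma ((Module.finrank ℝ E + κ + 1) / 2) / Gamma ((1 - κ) / 2) ∧
      ∀ s, 0 < s → ∀ w ν : E, ‖w‖ = 1 → oscIntegral κ w ν (gaussProfile s) =
        Complex.I * ((⟪w, ν⟫_ℝ * j s : ℝ) : ℂ) := by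
  -- Any m with β = (1 - κ)/2 + m > 1 serves. The value at 0 does not depend on it, since ∏(γ +
  -- i)/Γ(γ + m) = 1/Γ(γ) for γ = (1 - κ)/2, which is not a pole of Γ as κ is not a positive odd
  -- integer.
  obtain ⟨m, hm⟩ := exists_nat_gt (1 - (1 - κ) / 2)
  have hm1 : 1 < (1 - κ) / 2 + m := by linarith
  have hγ : ∀ i : ℕ, (1 - κ) / 2 + i ≠ 0 := fun i h => hodd i (by linarith)
  obtain ⟨hI, hval⟩ := integrableOn_and_integral_rpow_mul_flatPow m
    (b := (Module.finrank ℝ E : ℝ) / 2 + 1) (γ := (1 - κ) / 2) (by linarith)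
  set c : ℝ := π ^ ((Module.finrank ℝ E : ℝ) / 2) / 2 / Gamma ((1 - κ) / 2 + m) with hc
  refine ⟨fun s => c *
    flatFracIntegral m ((Module.finrank ℝ E : ℝ) / 2 + 1) ((1 - κ) / 2 + m) s,
    continuous_const.mul (continuous_flatFracIntegral hm1 hI), 
    ⟨|c| * ∫ u in Ioi (0 : ℝ), ‖u ^ ((1 - κ) / 2 + m - 1) *
      flatPow m ((Module.finrank ℝ E : ℝ) / 2 + 1) u‖, fun s => ?_⟩, ?_, ?_⟩
  · rw [abs_mul]
    exact mul_le_mul_of_nonneg_left (abs_flatFracIntegral_le hm1 hI s) (abs_nonneg _)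
  · have h0 : flatFracIntegral m ((Module.finrank ℝ E : ℝ) / 2 + 1) ((1 - κ) / 2 + m) 0 =
        ∫ u in Ioi (0 : ℝ), u ^ ((1 - κ) / 2 + m - 1) *
          flatPow m ((Module.finrank ℝ E : ℝ) / 2 + 1) u := by
      refine setIntegral_congr_fun measurableSet_Ioi fun u (hu : 0 < u) => ?_
      simp [hu.le]
    have hP : ∏ i ∈ Finset.range m, ((1 - κ) / 2 + (i : ℝ)) ≠ 0 :=
      Finset.prod_ne_zero_iff.2 fun i _ => hγ i
    have hG : Gamma ((1 - κ) / 2) ≠ 0 := Gamma_ne_zero fun i h => hγ i (by rw [h]; ring)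
    simp only [hc, h0, hval, Gamma_add_natCast m hγ]
    rw [show (Module.finrank ℝ E : ℝ) / 2 + 1 - (1 - κ) / 2 = (Module.finrank ℝ E + κ + 1) / 2
      by ring]
    generalize ∏ i ∈ Finset.range m, ((1 - κ) / 2 + (i : ℝ)) = P at hP
    field_simp
  · intro s hs w ν hw
    exact oscIntegral_gaussProfile hκ m hm1 hs hw ν
end

/-! ### Gaussian mixtures -/

/-- Continuity handles s near 0; elsewhere 1 - e^(-s) is bounded below and boundedness of j
suffices. This majorant integrates to a Laplace transform at 1, so no weak convergence of the mixing
measures is required. -/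
theorem exists_abs_sub_le_add_mul_one_sub_exp {j : ℝ → ℝ} (hj : Continuous j) {B : ℝ}
    (hB : ∀ s, |j s| ≤ B) {ε : ℝ} (hε : 0 < ε) :
    ∃ C, 0 ≤ C ∧ ∀ s, 0 ≤ s → |j s - j 0| ≤ ε + C * (1 - exp (-s)) := by
  obtain ⟨δ, hδ, h⟩ := Metric.continuousAt_iff.1 (hj.continuousAt (x := 0)) ε hε
  have hB0 : 0 ≤ B := (abs_nonneg _).trans (hB 0)
  have h1 : 0 < 1 - exp (-δ) := by simpa using hδ
  refine ⟨2 * B / (1 - exp (-δ)), by positivity, fun s hs => ?_⟩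
  have h2 : 0 ≤ 1 - exp (-s) := by simpa using hs
  rcases lt_or_ge s δ with hsδ | hsδ
  · have := h (x := s) (by simpa [abs_of_nonneg hs] using hsδ)
    rw [Real.dist_eq] at this
    have : 0 ≤ 2 * B / (1 - exp (-δ)) * (1 - exp (-s)) := by positivity
    linarith
  · have h3 : |j s - j 0| ≤ 2 * B := by
      have := abs_sub (j s) (j 0)
      linarith [hB s, hB 0]
    have h4 : 1 - exp (-δ) ≤ 1 - exp (-s) := by gcongr
    have : 2 * B ≤ 2 * B / (1 - exp (-δ)) * (1 - exp (-s)) := by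
      rw [div_mul_eq_mul_div, le_div_iff₀ h1]
      gcongr
    linarith

/-- The radial profile of the Gaussian mixture with mixing measure `μ`. -/
noncomputable def mixProfile (μ : Measure ℝ) (r : ℝ) : ℝ := ∫ t, gaussProfile t r ∂μ

theorem measurable_uncurry_gaussProfile : Measurable (Function.uncurry gaussProfile) := by
  unfold Function.uncurry gaussProfile
  fun_prop

theorem measurable_mixProfile (μ : Measure ℝ) [IsProbabilityMeasure μ] :
    Measurable (mixProfile μ) :=
  (StronglyMeasurable.integral_prod_right (f := fun r t => gaussProfile t r) (ν := μ)
    (measurable_uncurry_gaussProfile.comp measurable_swap).stronglyMeasurable).measurable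

theorem gaussProfile_pos (t r : ℝ) : 0 < gaussProfile t r := exp_pos _

theorem gaussProfile_le_one {t : ℝ} (ht : 0 ≤ t) (r : ℝ) : gaussProfile t r ≤ 1 := by
  rw [gaussProfile, exp_le_one_iff]
  nlinarith [sq_nonneg r, mul_nonneg ht (sq_nonneg r)]

theorem gaussProfile_add (s t r : ℝ) :
    gaussProfile (s + t) r = gaussProfile s r * gaussProfile t r := by
  rw [gaussProfile, gaussProfile, gaussProfile, ← Real.exp_add]
  congr 1
  ring

theorem integrable_gaussProfile (μ : Measure ℝ) [IsProbabilityMeasure μ] (hμ : ∀ᵐ t ∂μ, 0 ≤ t)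
    (r : ℝ) : Integrable (fun t => gaussProfile t r) μ := by
  refine (integrable_const (1 : ℝ)).mono'
    (measurable_uncurry_gaussProfile.comp (measurable_id.prodMk measurable_const)).aestronglyMeasurable
    (hμ.mono fun t ht => ?_)
  change ‖gaussProfile t r‖ ≤ 1
  rw [Real.norm_of_nonneg (gaussProfile_pos t r).le]
  exact gaussProfile_le_one ht r

theorem mixProfile_nonneg (μ : Measure ℝ) (r : ℝ) : 0 ≤ mixProfile μ r :=
  integral_nonneg fun t => (gaussProfile_pos t r).le

theorem mixProfile_le_one (μ : Measure ℝ) [IsProbabilityMeasure μ] (hμ : ∀ᵐ t ∂μ, 0 ≤ t) (r : ℝ) :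
    mixProfile μ r ≤ 1 := by
  have := integral_mono_ae (integrable_gaussProfile μ hμ r) (integrable_const (1 : ℝ))
    (hμ.mono fun t ht => gaussProfile_le_one ht r)
  simpa [mixProfile] using this

section
variable {E : Type*} [NormedAddCommGroup E] [InnerProductSpace ℝ E] [FiniteDimensional ℝ E]
  [MeasurableSpace E] [BorelSpace E] [Nontrivial E]

/-- The factor `gaussProfile δ` supplies the integrability in η that Fubini needs: a mixing measure
may charge 0, and the mixture alone then does not decay. -/
theorem oscIntegral_mixProfile {κ : ℝ} (hκ : -(Module.finrank ℝ E : ℝ) < κ) (μ : Measure ℝ)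
    [IsProbabilityMeasure μ] (hμ : ∀ᵐ t ∂μ, 0 ≤ t) {δ : ℝ} (hδ : 0 < δ) (w ν : E) :
    oscIntegral κ w ν (fun r => mixProfile μ r * gaussProfile δ r) =
      ∫ t, oscIntegral κ w ν (gaussProfile (t + δ)) ∂μ := by
  have hmeas : Measurable (Function.uncurry fun (η : E) t =>
      oscIntegrand κ w ν (gaussProfile (t + δ)) η) := by
    have h1 : Measurable fun p : E × ℝ => gaussProfile (p.2 + δ) ‖p.1‖ :=
      measurable_uncurry_gaussProfile.comp
        ((measurable_snd.add_const δ).prodMk measurable_fst.norm)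
    unfold Function.uncurry oscIntegrand
    fun_prop
  have hint : Integrable (Function.uncurry fun (η : E) t =>
      oscIntegrand κ w ν (gaussProfile (t + δ)) η) (volume.prod μ) := by
    have h1 : Integrable (fun p : E × ℝ => ‖ν‖ * (‖p.1‖ ^ κ * exp (-(δ * ‖p.1‖ ^ (2 : ℝ)))))
        (volume.prod μ) :=
      ((integrable_norm_rpow_mul_exp (E := E) hκ two_pos hδ).const_mul ‖ν‖).comp_fst μ
    refine h1.mono' hmeas.aestronglyMeasurable ?_
    filter_upwards [Measure.quasiMeasurePreserving_snd.ae hμ] with p hp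
    refine (norm_oscIntegrand_le κ w ν _ _).trans ?_
    gcongr
    exact abs_gaussProfile_le (by linarith) _
  unfold oscIntegral
  rw [← integral_integral_swap hint]
  refine integral_congr_ae (ae_of_all _ fun η => ?_)
  have : ∀ t, oscIntegrand κ w ν (gaussProfile (t + δ)) η =
      ((gaussProfile t ‖η‖ : ℝ) : ℂ) * oscIntegrand κ w ν (gaussProfile δ) η := by
    intro t
    rw [oscIntegrand, oscIntegrand, gaussProfile_add]
    push_cast
    ring
  simp only [this]
  rw [integral_mul_const, integral_complex_ofReal, oscIntegrand, oscIntegrand]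
  change _ = ((mixProfile μ ‖η‖ : ℝ) : ℂ) * _
  push_cast
  ring

theorem norm_oscIntegral_mixProfile_sub_le {κ : ℝ} (hκ : -(Module.finrank ℝ E : ℝ) < κ)
    {j : ℝ → ℝ} (hj : Continuous j) {B : ℝ} (hB : ∀ s, |j s| ≤ B)
    {w ν : E} (hosc : ∀ s, 0 < s → oscIntegral κ w ν (gaussProfile s) =
      Complex.I * ((⟪w, ν⟫_ℝ * j s : ℝ) : ℂ))
    {ε C : ℝ} (hC : ∀ s, 0 ≤ s → |j s - j 0| ≤ ε + C * (1 - exp (-s)))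
    (μ : Measure ℝ) [IsProbabilityMeasure μ] (hμ : ∀ᵐ t ∂μ, 0 ≤ t) {δ : ℝ} (hδ : 0 < δ) :
    ‖oscIntegral κ w ν (fun r => mixProfile μ r * gaussProfile δ r) -
      Complex.I * ((⟪w, ν⟫_ℝ * j 0 : ℝ) : ℂ)‖ ≤
      |⟪w, ν⟫_ℝ| * (ε + C * (1 - mixProfile μ 1 * gaussProfile δ 1)) := by
  have hI : Integrable (fun t => j (t + δ)) μ :=
    (integrable_const B).mono' (hj.comp (continuous_add_const δ)).aestronglyMeasurable
      (ae_of_all _ fun t => hB _)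
  have h1 : oscIntegral κ w ν (fun r => mixProfile μ r * gaussProfile δ r) =
      Complex.I * ((⟪w, ν⟫_ℝ * ∫ t, j (t + δ) ∂μ : ℝ) : ℂ) := by
    rw [oscIntegral_mixProfile hκ μ hμ hδ, ← integral_const_mul, ← integral_complex_ofReal,
      ← integral_const_mul]
    exact integral_congr_ae (hμ.mono fun t ht => hosc _ (by linarith))
  rw [h1, ← mul_sub, ← Complex.ofReal_sub, ← mul_sub, norm_mul, Complex.norm_I, one_mul,
    Complex.norm_real, Real.norm_eq_abs, abs_mul]
  gcongr
  have h2 : (∫ t, j (t + δ) ∂μ) - j 0 = ∫ t, (j (t + δ) - j 0) ∂μ := by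
    rw [integral_sub hI (integrable_const _)]
    simp
  have hg : Integrable (fun t => gaussProfile t 1 * gaussProfile δ 1) μ :=
    (integrable_gaussProfile μ hμ 1).mul_const _
  have hg' : Integrable (fun t => 1 - gaussProfile t 1 * gaussProfile δ 1) μ :=
    (integrable_const _).sub hg
  have h3 : ε + C * (1 - mixProfile μ 1 * gaussProfile δ 1) =
      ∫ t, (ε + C * (1 - gaussProfile t 1 * gaussProfile δ 1)) ∂μ := by
    rw [integral_add (integrable_const _) (hg'.const_mul _),
      integral_const_mul, integral_sub (integrable_const _) hg, integral_mul_const, mixProfile]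
    simp
  rw [h2, h3, ← Real.norm_eq_abs]
  refine norm_integral_le_of_norm_le
    ((integrable_const _).add (hg'.const_mul _))
    (hμ.mono fun t ht => ?_)
  refine (hC (t + δ) (by linarith)).trans_eq ?_
  rw [← gaussProfile_add, gaussProfile]
  simp

/-- Two dominated limits in succession: n → ∞ with δ fixed, dominated by the Gaussian factor, and
then δ → 0, dominated by the decay of h itself. -/
theorem norm_oscIntegral_sub_le_of_tendsto {κ : ℝ} (hκ : -(Module.finrank ℝ E : ℝ) < κ)
    {j : ℝ → ℝ} (hj : Continuous j) {B : ℝ} (hB : ∀ s, |j s| ≤ B)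
    {w ν : E} (hosc : ∀ s, 0 < s → oscIntegral κ w ν (gaussProfile s) =
      Complex.I * ((⟪w, ν⟫_ℝ * j s : ℝ) : ℂ))
    {ε C : ℝ} (hC : ∀ s, 0 ≤ s → |j s - j 0| ≤ ε + C * (1 - exp (-s)))
    (μ : ℕ → Measure ℝ) [∀ n, IsProbabilityMeasure (μ n)] (hμ : ∀ n, ∀ᵐ t ∂μ n, 0 ≤ t)
    {h : ℝ → ℝ} (hlim : ∀ r, 0 ≤ r → Tendsto (fun n => mixProfile (μ n) r) atTop (𝓝 (h r)))
    (hm : Measurable h) {s p : ℝ} (hs : 0 < s) (hp : 0 < p)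
    (hh : ∀ r, 0 ≤ r → |h r| ≤ exp (-(s * r ^ p))) :
    ‖oscIntegral κ w ν h - Complex.I * ((⟪w, ν⟫_ℝ * j 0 : ℝ) : ℂ)‖ ≤
      |⟪w, ν⟫_ℝ| * (ε + C * (1 - h 1)) := by
  have step : ∀ δ, 0 < δ → ‖oscIntegral κ w ν (fun r => h r * gaussProfile δ r) -
      Complex.I * ((⟪w, ν⟫_ℝ * j 0 : ℝ) : ℂ)‖ ≤
      |⟪w, ν⟫_ℝ| * (ε + C * (1 - h 1 * gaussProfile δ 1)) := by
    intro δ hδ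
    have hL : Tendsto (fun n => oscIntegral κ w ν (fun r => mixProfile (μ n) r * gaussProfile δ r))
        atTop (𝓝 (oscIntegral κ w ν (fun r => h r * gaussProfile δ r))) := by
      refine tendsto_integral_of_dominated_convergence
        (fun η => ‖ν‖ * (‖η‖ ^ κ * exp (-(δ * ‖η‖ ^ (2 : ℝ)))))
        (fun n => (measurable_oscIntegrand κ w ν
          ((measurable_mixProfile _).mul (measurable_gaussProfile δ))).aestronglyMeasurable)
        ((integrable_norm_rpow_mul_exp hκ two_pos hδ).const_mul _)
        (fun n => ae_of_all _ fun η => ?_) (ae_of_all _ fun η => ?_)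
      · refine (norm_oscIntegrand_le κ w ν _ _).trans ?_
        gcongr
        rw [abs_mul, abs_of_nonneg (mixProfile_nonneg _ _)]
        exact (mul_le_of_le_one_left (abs_nonneg _) (mixProfile_le_one _ (hμ n) _)).trans
          (abs_gaussProfile_le le_rfl _)
      · unfold oscIntegrand
        exact ((Complex.continuous_ofReal.tendsto _).comp
          (((hlim _ (norm_nonneg η)).mul_const _).const_mul _)).mul_const _
    exact le_of_tendsto_of_tendsto' (hL.sub_const _).norm
      ((((((hlim 1 zero_le_one).mul_const _).const_sub 1).const_mul C).const_add ε).const_mul _)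
      fun n => norm_oscIntegral_mixProfile_sub_le hκ hj hB hosc hC (μ n) (hμ n) hδ
  have hδ0 : Tendsto (fun n : ℕ => 1 / ((n : ℝ) + 1)) atTop (𝓝 0) :=
    tendsto_one_div_add_atTop_nhds_zero_nat
  have hG : ∀ r, Tendsto (fun n : ℕ => h r * gaussProfile (1 / ((n : ℝ) + 1)) r) atTop
      (𝓝 (h r)) := by
    intro r
    have hc : Continuous fun t => h r * gaussProfile t r := by unfold gaussProfile; fun_prop
    have := (hc.tendsto 0).comp hδ0
    simpa [gaussProfile, Function.comp_def] using this
  have hL : Tendsto (fun n : ℕ => oscIntegral κ w ν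
      (fun r => h r * gaussProfile (1 / ((n : ℝ) + 1)) r)) atTop (𝓝 (oscIntegral κ w ν h)) := by
    refine tendsto_integral_of_dominated_convergence
      (fun η => ‖ν‖ * (‖η‖ ^ κ * exp (-(s * ‖η‖ ^ p))))
      (fun n => (measurable_oscIntegrand κ w ν
        (hm.mul (measurable_gaussProfile _))).aestronglyMeasurable)
      ((integrable_norm_rpow_mul_exp hκ hp hs).const_mul _)
      (fun n => ae_of_all _ fun η => ?_) (ae_of_all _ fun η => ?_)
    · refine (norm_oscIntegrand_le κ w ν _ _).trans ?_
      gcongr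
      rw [abs_mul, abs_of_pos (gaussProfile_pos _ _)]
      exact (mul_le_of_le_one_right (abs_nonneg _) (gaussProfile_le_one (by positivity) _)).trans
        (hh _ (norm_nonneg _))
    · unfold oscIntegrand
      exact ((Complex.continuous_ofReal.tendsto _).comp
        ((hG ‖η‖).const_mul _)).mul_const _
  exact le_of_tendsto_of_tendsto' (hL.sub_const _).norm
    (((((hG 1).const_sub 1).const_mul C).const_add ε).const_mul _)
    fun n => step _ (by positivity)
end

/-! ### One-sided stable laws from Pareto sums -/

section stable
variable {a : ℝ}

/-- The integrand is at most 1 near 0 and at most v^(-1/a) at infinity, where a < 1 makes the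
exponent integrable. This is the source of the restriction α < 2. -/
theorem integrableOn_one_sub_exp_neg_rpow (ha : 0 < a) (ha1 : a < 1) :
    IntegrableOn (fun v : ℝ => 1 - exp (-(v ^ (-(1 / a))))) (Ioi 0) := by
  have hmeas : Measurable fun v : ℝ => 1 - exp (-(v ^ (-(1 / a)))) := by fun_prop
  have hnn : ∀ v : ℝ, 0 < v → 0 ≤ 1 - exp (-(v ^ (-(1 / a)))) := fun v hv => by
    have : 0 ≤ v ^ (-(1 / a)) := by positivity
    simpa using this
  rw [← Ioc_union_Ioi_eq_Ioi zero_le_one, integrableOn_union]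
  constructor
  · refine Integrable.mono' (g := fun _ => (1 : ℝ)) (integrable_const _)
      hmeas.aestronglyMeasurable
      ((ae_restrict_mem measurableSet_Ioc).mono fun v hv => ?_)
    rw [Real.norm_of_nonneg (hnn v hv.1)]
    linarith [exp_pos (-(v ^ (-(1 / a))))]
  · have h1 : 1 < 1 / a := by rw [lt_div_iff₀ ha]; linarith
    refine Integrable.mono' (integrableOn_Ioi_rpow_of_lt (a := -(1 / a)) (by linarith) one_pos)
      hmeas.aestronglyMeasurable
      ((ae_restrict_mem measurableSet_Ioi).mono fun v (hv : 1 < v) => ?_)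
    rw [Real.norm_of_nonneg (hnn v (by linarith))]
    linarith [add_one_le_exp (-(v ^ (-(1 / a))))]

theorem integral_one_sub_exp_neg_rpow_pos (ha : 0 < a) (ha1 : a < 1) :
    0 < ∫ v in Ioi (0 : ℝ), (1 - exp (-(v ^ (-(1 / a))))) := by
  have hpos : ∀ v : ℝ, 0 < v → 0 < 1 - exp (-(v ^ (-(1 / a)))) := fun v hv => by
    have : 0 < v ^ (-(1 / a)) := by positivity
    simpa using this
  have hsub : Ioi (0 : ℝ) ⊆ Function.support fun v : ℝ => 1 - exp (-(v ^ (-(1 / a)))) :=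
    fun v hv => (hpos v hv).ne'
  rw [setIntegral_pos_iff_support_of_nonneg_ae
    ((ae_restrict_mem measurableSet_Ioi).mono fun v hv => (hpos v hv).le)
    (integrableOn_one_sub_exp_neg_rpow ha ha1),
    inter_eq_self_of_subset_right hsub]
  simp

/-- The Laplace transform of the Pareto law, the law of `U ^ (-1 / a)` for uniform `U`. -/
theorem integral_exp_neg_mul_rpow_sub_one (ha : 0 < a) {q : ℝ} (hq : 0 < q) :
    (∫ u in Ioc (0 : ℝ) 1, exp (-(q * |u| ^ (-(1 / a))))) - 1 =
      -(q ^ a * ∫ v in (0 : ℝ)..q ^ (-a), (1 - exp (-(v ^ (-(1 / a)))))) := by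
  have hc : q ^ (-a) ≠ 0 := (rpow_pos_of_pos hq _).ne'
  have h1 := intervalIntegral.integral_comp_mul_left (a := 0) (b := 1)
    (fun v : ℝ => 1 - exp (-(v ^ (-(1 / a))))) hc
  rw [mul_zero, mul_one, smul_eq_mul, ← rpow_neg hq.le, neg_neg] at h1
  rw [← h1, intervalIntegral.integral_of_le zero_le_one]
  have hI : IntegrableOn (fun u : ℝ => exp (-(q * |u| ^ (-(1 / a))))) (Ioc 0 1) := by
    refine Integrable.mono' (g := fun _ => (1 : ℝ)) (integrable_const _)
      (by fun_prop : Measurable fun u : ℝ => exp (-(q * |u| ^ (-(1 / a))))).aestronglyMeasurable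
      (ae_of_all _ fun u => ?_)
    rw [Real.norm_of_nonneg (exp_pos _).le, exp_le_one_iff, neg_nonpos]
    positivity
  have h2 : ∫ u in Ioc (0 : ℝ) 1, (1 - exp (-((q ^ (-a) * u) ^ (-(1 / a))))) =
      ∫ u in Ioc (0 : ℝ) 1, (1 - exp (-(q * |u| ^ (-(1 / a))))) := by
    refine setIntegral_congr_fun measurableSet_Ioc fun u hu => ?_
    have h3 : -a * -(1 / a) = 1 := by field_simp
    rw [mul_rpow (by positivity) hu.1.le, ← rpow_mul hq.le, h3, rpow_one, abs_of_pos hu.1]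
  rw [h2, integral_sub (integrable_const _) hI]
  simp

/-- One-sided stable laws as limits of normalised sums of Pareto variables: the Laplace transforms
of the sums converge to `exp (-(τ p ^ a))`. -/
theorem exists_measure_tendsto_exp_neg_rpow (ha : 0 < a) (ha1 : a < 1) {τ : ℝ} (hτ : 0 < τ) :
    ∃ μ : ℕ → Measure ℝ, (∀ n, IsProbabilityMeasure (μ n)) ∧ (∀ n, ∀ᵐ t ∂μ n, 0 ≤ t) ∧
      ∀ p, 0 ≤ p → Tendsto (fun n => ∫ t, exp (-(t * p)) ∂μ n) atTop
        (𝓝 (exp (-(τ * p ^ a)))) := by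
  set A := ∫ v in Ioi (0 : ℝ), (1 - exp (-(v ^ (-(1 / a))))) with hA
  have hA0 : 0 < A := integral_one_sub_exp_neg_rpow_pos ha ha1
  -- The scale is fixed by σ^a A = τ, because n times (Laplace transform of one summand - 1) tends
  -- to -(σp)^a A.
  set σ : ℝ := (τ / A) ^ (1 / a) with hσ
  have hσ0 : 0 < σ := by positivity
  have hσa : σ ^ a * A = τ := by
    rw [hσ, ← rpow_mul (by positivity), one_div_mul_cancel ha.ne', rpow_one]
    field_simp
  let S : (n : ℕ) → (Fin n → ℝ) → ℝ :=
    fun n x => ∑ i, σ * (n : ℝ) ^ (-(1 / a)) * |x i| ^ (-(1 / a))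
  have hS : ∀ n, Measurable (S n) := fun n => by
    refine Finset.measurable_sum _ fun i _ => ?_
    have := measurable_pi_apply (X := fun _ : Fin n => ℝ) i
    fun_prop
  let P : (n : ℕ) → Measure (Fin n → ℝ) :=
    fun n => Measure.pi fun _ => (volume : Measure ℝ).restrict (Ioc 0 1)
  have hU : IsProbabilityMeasure ((volume : Measure ℝ).restrict (Ioc 0 1)) := ⟨by simp⟩
  have hP : ∀ n, IsProbabilityMeasure (P n) := fun n => by infer_instance
  refine ⟨fun n => (P n).map (S n), fun n => Measure.isProbabilityMeasure_map
    (hS n).aemeasurable, fun n => ?_, fun p hp => ?_⟩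
  · rw [ae_map_iff (hS n).aemeasurable measurableSet_Ici]
    exact ae_of_all _ fun x => Finset.sum_nonneg fun i _ => by positivity
  have hL : ∀ n : ℕ, ∫ t, exp (-(t * p)) ∂((P n).map (S n)) =
      (1 + ((∫ u in Ioc (0 : ℝ) 1,
        exp (-((σ * (n : ℝ) ^ (-(1 / a)) * p) * |u| ^ (-(1 / a))))) - 1)) ^ n := by
    intro n
    rw [integral_map (hS n).aemeasurable (by fun_prop), add_sub_cancel]
    have h1 := integral_fintype_prod_eq_pow (ι := Fin n)
      (fun u : ℝ => exp (-((σ * (n : ℝ) ^ (-(1 / a)) * p) * |u| ^ (-(1 / a)))))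
      (μ := (volume : Measure ℝ).restrict (Ioc 0 1))
    rw [Fintype.card_fin] at h1
    rw [← h1]
    refine integral_congr_ae (ae_of_all _ fun x => ?_)
    simp only [S]
    rw [← Real.exp_sum, Finset.sum_neg_distrib, Finset.sum_mul]
    congr 2
    exact Finset.sum_congr rfl fun i _ => by ring
  simp only [hL]
  refine Real.tendsto_one_add_pow_exp_of_tendsto ?_
  rcases hp.eq_or_lt with rfl | hp
  · simp [zero_rpow ha.ne']
  -- With q = σ n^(-1/a) p one has q^a = (σp)^a / n and q^(-a) = n (σp)^(-a): the factor n cancels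
  -- and the truncated integral exhausts the half-line.
  have hbd : Tendsto (fun n : ℕ => (n : ℝ) * (σ * p) ^ (-a)) atTop atTop :=
    tendsto_natCast_atTop_atTop.atTop_mul_const (by positivity)
  have hlim := (intervalIntegral_tendsto_integral_Ioi 0
    (integrableOn_one_sub_exp_neg_rpow ha ha1) hbd).const_mul (-(σ * p) ^ a)
  rw [← hA] at hlim
  have hval : -(σ * p) ^ a * A = -(τ * p ^ a) := by
    rw [mul_rpow hσ0.le hp.le, ← hσa]; ring
  rw [hval] at hlim
  refine hlim.congr' ?_
  filter_upwards [eventually_gt_atTop 0] with n hn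
  have hn0 : (0 : ℝ) < n := by exact_mod_cast hn
  have hq : 0 < σ * (n : ℝ) ^ (-(1 / a)) * p := by positivity
  rw [integral_exp_neg_mul_rpow_sub_one ha hq]
  have h1 : ∀ e : ℝ, (σ * (n : ℝ) ^ (-(1 / a)) * p) ^ e = (n : ℝ) ^ (-(1 / a) * e) * (σ * p) ^ e := by
    intro e
    rw [show σ * (n : ℝ) ^ (-(1 / a)) * p = (n : ℝ) ^ (-(1 / a)) * (σ * p) by ring,
      mul_rpow (by positivity) (by positivity), ← rpow_mul hn0.le]
  rw [h1, h1, show -(1 / a) * -a = 1 by field_simp, show -(1 / a) * a = -1 by field_simp,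
    rpow_one, rpow_neg_one]
  field_simp
end stable

/-! ### The Abel limit -/

section
variable {E : Type*} [NormedAddCommGroup E] [InnerProductSpace ℝ E] [FiniteDimensional ℝ E]
  [MeasurableSpace E] [BorelSpace E] [Nontrivial E]

/-- Abel limit of the oscillatory integrals regularised by `exp (-(τ r ^ α))` as `τ → 0`. -/
theorem exists_forall_norm_oscIntegral_sub_le {κ α : ℝ} (hκ : -(Module.finrank ℝ E : ℝ) < κ)
    (hodd : ∀ i : ℕ, κ ≠ 2 * i + 1) (hα0 : 0 < α) (hα2 : α < 2) {ε : ℝ} (hε : 0 < ε) :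
    ∃ τ₀, 0 < τ₀ ∧ ∀ τ, 0 < τ → τ ≤ τ₀ → ∀ w ν : E, ‖w‖ = 1 →
      ‖oscIntegral κ w ν (fun r => exp (-(τ * r ^ α))) - Complex.I * ((⟪w, ν⟫_ℝ *
        (π ^ ((Module.finrank ℝ E : ℝ) / 2) / 2 * 4 ^ ((Module.finrank ℝ E + κ + 1) / 2) *
        Gamma ((Module.finrank ℝ E + κ + 1) / 2) / Gamma ((1 - κ) / 2)) : ℝ) : ℂ)‖ ≤
      |⟪w, ν⟫_ℝ| * ε := by
  obtain ⟨j, hj, ⟨B, hB⟩, hj0, hosc⟩ := exists_gaussian_regularization (E := E) hκ hodd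
  obtain ⟨C, hC0, hC⟩ := exists_abs_sub_le_add_mul_one_sub_exp hj hB (half_pos hε)
  -- Since 1 - e^(-τ) ≤ τ, this threshold keeps C(1 - e^(-τ)) below ε/2; C + 1 avoids division by
  -- zero.
  refine ⟨ε / (2 * (C + 1)), by positivity, fun τ hτ hτ0 w ν hw => ?_⟩
  obtain ⟨μ, hμP, hμ0, hμ⟩ := exists_measure_tendsto_exp_neg_rpow (a := α / 2) (by linarith)
    (by linarith) hτ
  rw [← hj0]
  refine (norm_oscIntegral_sub_le_of_tendsto hκ hj hB (fun s hs => hosc s hs w ν hw) hC μ hμ0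
    (h := fun r => exp (-(τ * r ^ α))) (fun r hr => ?_) (by fun_prop) hτ hα0
    (fun r _ => by rw [abs_exp])).trans ?_
  -- The Laplace variable is p = r², so index α/2 gives p^(α/2) = r^α.
  · have := hμ (r ^ 2) (by positivity)
    rwa [← rpow_two, ← rpow_mul hr, mul_div_cancel₀ _ two_ne_zero, rpow_two] at this
  · gcongr
    have h1 : 1 - exp (-(τ * 1 ^ α)) ≤ τ := by
      rw [one_rpow, mul_one]
      linarith [add_one_le_exp (-τ)]
    have h2 : C * (1 - exp (-(τ * 1 ^ α))) ≤ ε / 2 := by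
      calc C * (1 - exp (-(τ * 1 ^ α))) ≤ (C + 1) * (ε / (2 * (C + 1))) := by
            refine mul_le_mul (by linarith) (h1.trans hτ0) ?_ (by linarith)
            rw [one_rpow, mul_one, sub_nonneg, exp_le_one_iff]
            linarith
        _ = ε / 2 := by field_simp
    linarith

end

/-! ### Scaling, the constant, and the conclusion -/

/-- Dilation by |x|: the Jacobian accounts for the dimension and the homogeneity of ⟪ν, ξ⟫ |ξ|^(κ-1)
for κ. -/
theorem integral_oscIntegrand_exp_neg_rpow {E : Type*} [NormedAddCommGroup E]
    [InnerProductSpace ℝ E] [FiniteDimensional ℝ E] [MeasurableSpace E] [BorelSpace E] (κ α : ℝ) {x : E} (hx : x ≠ 0) (ν : E) :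
    ∫ ξ, oscIntegrand κ x ν (fun r => exp (-(r ^ α))) ξ =
      ((‖x‖ ^ (-(Module.finrank ℝ E + κ)) : ℝ) : ℂ) *
        oscIntegral κ (‖x‖⁻¹ • x) ν (fun r => exp (-(‖x‖ ^ (-α) * r ^ α))) := by
  have h0 : 0 < ‖x‖ := norm_pos_iff.2 hx
  have h1 := Measure.integral_comp_smul (volume : Measure E)
    (oscIntegrand κ (‖x‖⁻¹ • x) ν (fun r => exp (-(‖x‖ ^ (-α) * r ^ α)))) ‖x‖
  have h2 : ∀ ξ : E, oscIntegrand κ (‖x‖⁻¹ • x) ν (fun r => exp (-(‖x‖ ^ (-α) * r ^ α)))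
      (‖x‖ • ξ) = ((‖x‖ ^ κ : ℝ) : ℂ) * oscIntegrand κ x ν (fun r => exp (-(r ^ α))) ξ := by
    intro ξ
    have h0c : (‖x‖ : ℂ) ≠ 0 := by exact_mod_cast h0.ne'
    unfold oscIntegrand
    beta_reduce
    rw [real_inner_smul_left, real_inner_smul_right, real_inner_smul_right, norm_smul, norm_norm,
      mul_rpow h0.le (norm_nonneg _), mul_rpow h0.le (norm_nonneg _), inv_mul_cancel_left₀ h0.ne',
      ← mul_assoc (‖x‖ ^ (-α)), ← rpow_add h0, neg_add_cancel, rpow_zero, one_mul,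
      rpow_sub_one h0.ne']
    push_cast
    field_simp
  simp only [h2] at h1
  rw [integral_const_mul, abs_of_pos (by positivity), Complex.real_smul] at h1
  change _ = _ * oscIntegral _ _ _ _ at h1
  rw [neg_add, rpow_add h0, rpow_neg h0.le κ, rpow_neg h0.le, rpow_natCast]
  have h3 : ((‖x‖ ^ κ : ℝ) : ℂ) ≠ 0 := by exact_mod_cast (rpow_pos_of_pos h0 κ).ne'
  refine mul_left_cancel₀ h3 (h1.trans ?_)
  push_cast
  field_simp

/-- Euler's reflection formula at (κ + 1)/2 trades Γ((κ + 1)/2) cos(κπ/2) for π/Γ((1 - κ)/2). -/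
theorem fracGradConst_eq (d : ℕ) {κ : ℝ} (hκ : ∀ i : ℕ, (1 - κ) / 2 ≠ -i)
    (hκ' : -1 < κ) : fracGradConst d κ = 1 / (2 * π) ^ d *
      (π ^ ((d : ℝ) / 2) / 2 * 4 ^ (((d : ℝ) + κ + 1) / 2) *
        Gamma (((d : ℝ) + κ + 1) / 2) / Gamma ((1 - κ) / 2)) := by
  have h1 := Real.Gamma_mul_Gamma_one_sub ((κ + 1) / 2)
  rw [show 1 - (κ + 1) / 2 = (1 - κ) / 2 by ring,
    show π * ((κ + 1) / 2) = κ * π / 2 + π / 2 by ring, Real.sin_add_pi_div_two] at h1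
  have hG : Gamma ((1 - κ) / 2) ≠ 0 := Real.Gamma_ne_zero hκ
  have hG' : 0 < Gamma ((κ + 1) / 2) := Gamma_pos_of_pos (by linarith)
  -- A vanishing cosine would make the right side of the reflection formula 0, as division by zero
  -- yields 0, although neither Gamma factor vanishes.
  have hcos : cos (κ * π / 2) ≠ 0 := by
    intro h
    rw [h, div_zero] at h1
    exact mul_ne_zero hG'.ne' hG h1
  have h4 : (4 : ℝ) ^ (((d : ℝ) + κ + 1) / 2) = 2 ^ d * 2 ^ κ * 2 := by
    rw [show (4 : ℝ) = 2 ^ (2 : ℝ) by norm_num, ← rpow_mul two_pos.le,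
      mul_div_cancel₀ _ two_ne_zero, rpow_add_one two_ne_zero, rpow_add two_pos, rpow_natCast]
  have hpi : π ^ ((d : ℝ) / 2) * π ^ ((d : ℝ) / 2) = π ^ d := by
    rw [← rpow_add pi_pos, add_halves, rpow_natCast]
  have h5 : Gamma ((κ + 1) / 2) * cos (κ * π / 2) = π / Gamma ((1 - κ) / 2) := by
    rw [eq_div_iff hG]
    rw [eq_div_iff hcos] at h1
    linarith
  rw [fracGradConst, h4, rpow_add_one pi_ne_zero, mul_pow, ← hpi]
  calc _ = 2 ^ κ / (π ^ ((d : ℝ) / 2) * π) * Gamma (((d : ℝ) + κ + 1) / 2) *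
        (Gamma ((κ + 1) / 2) * cos (κ * π / 2)) := by ring
    _ = _ := by
      rw [h5]
      have := rpow_pos_of_pos pi_pos ((d : ℝ) / 2)
      field_simp

theorem fracGradConst_ne_zero (d : ℕ) {κ : ℝ} (hκ : ∀ i : ℕ, (1 - κ) / 2 ≠ -i)
    (hκ' : -1 < κ) : fracGradConst d κ ≠ 0 := by
  rw [fracGradConst_eq d hκ hκ']
  have hG : Gamma ((1 - κ) / 2) ≠ 0 := Real.Gamma_ne_zero hκ
  have : 0 < Gamma (((d : ℝ) + κ + 1) / 2) :=
    Gamma_pos_of_pos (by linarith [(Nat.cast_nonneg d : (0 : ℝ) ≤ d)])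
  positivity

theorem norm_complexify {d : ℕ} (v : EuclideanSpace ℝ (Fin d)) : ‖complexify v‖ = ‖v‖ := by
  simp [complexify, EuclideanSpace.norm_eq]

theorem pairing_eq_inner {d : ℕ} (z : EuclideanSpace ℂ (Fin d)) (v : EuclideanSpace ℝ (Fin d)) :
    pairing z v = ⟪complexify v, z⟫_ℂ := by
  simp [pairing, complexify, PiLp.inner_apply]

theorem inner_complexify {d : ℕ} (v w : EuclideanSpace ℝ (Fin d)) :
    ⟪complexify v, complexify w⟫_ℂ = ((⟪v, w⟫_ℝ : ℝ) : ℂ) := by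
  simp [complexify, PiLp.inner_apply]

theorem continuous_complexify {d : ℕ} : Continuous (complexify (d := d)) := by
  unfold complexify
  fun_prop

/-- The pairing is a complex inner product with a real vector, so it passes inside the integral once
the vector integrand is shown integrable. -/
theorem pairing_fracGradKernel {d : ℕ} {α κ : ℝ} (hd : 1 ≤ d) (hα : 0 < α) (hκ : -(d : ℝ) < κ)
    (x ν : EuclideanSpace ℝ (Fin d)) : pairing (fracGradKernel α κ x) ν =
      1 / (2 * (π : ℂ)) ^ d * ∫ ξ, oscIntegrand κ x ν (fun r => exp (-(r ^ α))) ξ := by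
  have : Nontrivial (EuclideanSpace ℝ (Fin d)) :=
    Module.nontrivial_of_finrank_pos (R := ℝ) (by rw [finrank_euclideanSpace_fin]; omega)
  have hexp : ∀ ξ : EuclideanSpace ℝ (Fin d), (((‖ξ‖ ^ (κ - 1) : ℝ) : ℂ) *
      Complex.exp (Complex.I * ((inner ℝ x ξ : ℝ) : ℂ) - ((‖ξ‖ ^ α : ℝ) : ℂ))) =
      ((‖ξ‖ ^ (κ - 1) * exp (-(‖ξ‖ ^ α)) : ℝ) : ℂ) *
        Complex.exp (Complex.I * ((inner ℝ x ξ : ℝ) : ℂ)) := by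
    intro ξ
    rw [sub_eq_add_neg (Complex.I * _), Complex.exp_add]
    push_cast
    ring
  have hint : Integrable fun ξ : EuclideanSpace ℝ (Fin d) => (((‖ξ‖ ^ (κ - 1) : ℝ) : ℂ) *
      Complex.exp (Complex.I * ((inner ℝ x ξ : ℝ) : ℂ) - ((‖ξ‖ ^ α : ℝ) : ℂ))) • complexify ξ := by
    refine (integrable_norm_rpow_mul_exp (E := EuclideanSpace ℝ (Fin d)) (q := κ)
      (by rwa [finrank_euclideanSpace_fin]) hα one_pos).mono' ?_ ?_
    · refine AEStronglyMeasurable.smul (𝕜 := ℂ) (Measurable.aestronglyMeasurable ?_)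
        continuous_complexify.aestronglyMeasurable
      fun_prop
    · have hne : ∀ᵐ ξ : EuclideanSpace ℝ (Fin d), ξ ≠ 0 := by simp [ae_iff]
      filter_upwards [hne] with ξ hξ
      have h0 : 0 < ‖ξ‖ := norm_pos_iff.2 hξ
      rw [hexp, norm_smul, norm_ofReal_mul_cexp_inner, norm_complexify,
        abs_of_pos (by positivity), rpow_sub_one h0.ne', one_mul]
      exact le_of_eq (by field_simp)
  rw [pairing_eq_inner, fracGradKernel, inner_smul_right, ← integral_inner hint]
  congr 1
  refine integral_congr_ae (ae_of_all _ fun ξ => ?_)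
  simp only [hexp]
  rw [inner_smul_right, inner_complexify, oscIntegrand]
  push_cast
  ring

theorem theorem4 (d : ℕ) (α κ : ℝ) (hα0 : 0 < α) (hα2 : α < 2)
    (hκ : 1 - min (d : ℝ) 2 < κ) (hodd : ¬ ∃ n : ℤ, Odd n ∧ κ = (n : ℝ))
    (ν : EuclideanSpace ℝ (Fin d)) (hν : ‖ν‖ = 1) :
    (fun x : EuclideanSpace ℝ (Fin d) => pairing (fracGradKernel α κ x) ν)
      ~[Bornology.cobounded (EuclideanSpace ℝ (Fin d))]
    (fun x : EuclideanSpace ℝ (Fin d) =>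
      Complex.I * ((fracGradConst d κ : ℝ) : ℂ) *
        ((inner ℝ x ν / ‖x‖ ^ ((d : ℝ) + κ + 1) : ℝ) : ℂ)) := by
  have : Nontrivial (EuclideanSpace ℝ (Fin d)) :=
    ⟨ν, 0, fun h => by simp [h] at hν⟩
  have hfr : Module.finrank ℝ (EuclideanSpace ℝ (Fin d)) = d := finrank_euclideanSpace_fin
  have hd : 1 ≤ d := hfr ▸ Module.finrank_pos (R := ℝ) (M := EuclideanSpace ℝ (Fin d))
  have hd1 : (1 : ℝ) ≤ d := by exact_mod_cast hd
  have hκ1 : -1 < κ := by linarith [min_le_right (d : ℝ) 2]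
  have hodd' : ∀ i : ℕ, κ ≠ 2 * i + 1 := fun i h =>
    hodd ⟨2 * i + 1, ⟨i, rfl⟩, by push_cast; exact h⟩
  have hpole : ∀ i : ℕ, (1 - κ) / 2 ≠ -i := fun i h => hodd' i (by linarith)
  have hC0 := fracGradConst_ne_zero d hpole hκ1
  set M : ℝ := π ^ ((d : ℝ) / 2) / 2 * 4 ^ (((d : ℝ) + κ + 1) / 2) *
        Gamma (((d : ℝ) + κ + 1) / 2) / Gamma ((1 - κ) / 2) with hM
  have hCM : fracGradConst d κ = 1 / (2 * π) ^ d * M := fracGradConst_eq d hpole hκ1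
  have hM0 : M ≠ 0 := fun h => hC0 (by rw [hCM, h, mul_zero])
  refine Asymptotics.isLittleO_iff.2 fun ε hε => ?_
  obtain ⟨τ₀, hτ₀, hmain⟩ := exists_forall_norm_oscIntegral_sub_le
    (E := EuclideanSpace ℝ (Fin d)) (κ := κ) (by rw [hfr]; linarith) hodd' hα0 hα2
    -- The main term is ⟪w, ν⟫ M up to a common factor, so an error |⟪w, ν⟫| ε |M| is exactly a
    -- relative error ε, including where ⟪x, ν⟫ = 0.
    (ε := ε * |M|) (by positivity)
  simp only [hfr, ← hM] at hmain
  have htend : Tendsto (fun x : EuclideanSpace ℝ (Fin d) => ‖x‖ ^ (-α))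
      (Bornology.cobounded _) (𝓝 0) :=
    (tendsto_rpow_neg_atTop hα0).comp tendsto_norm_cobounded_atTop
  filter_upwards [htend.eventually_le_const hτ₀,
    tendsto_norm_cobounded_atTop.eventually_gt_atTop 0] with x hx hx0
  have hxne : x ≠ 0 := norm_pos_iff.1 hx0
  have hw : ‖‖x‖⁻¹ • x‖ = 1 := by rw [norm_smul, norm_inv, norm_norm, inv_mul_cancel₀ hx0.ne']
  have hb := hmain (‖x‖ ^ (-α)) (by positivity) hx (‖x‖⁻¹ • x) ν hw
  have hpow : ‖x‖ ^ (-((d : ℝ) + κ)) * ‖x‖⁻¹ = (‖x‖ ^ ((d : ℝ) + κ + 1))⁻¹ := by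
    rw [rpow_add_one hx0.ne', rpow_neg hx0.le, mul_inv]
  have hg : Complex.I * ((fracGradConst d κ : ℝ) : ℂ) *
      ((inner ℝ x ν / ‖x‖ ^ ((d : ℝ) + κ + 1) : ℝ) : ℂ) =
      ((1 / (2 * π) ^ d * ‖x‖ ^ (-((d : ℝ) + κ)) : ℝ) : ℂ) *
        (Complex.I * ((⟪‖x‖⁻¹ • x, ν⟫_ℝ * M : ℝ) : ℂ)) := by
    rw [div_eq_mul_inv, ← hpow, hCM, real_inner_smul_left]
    push_cast
    ring
  have hf : pairing (fracGradKernel α κ x) ν =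
      ((1 / (2 * π) ^ d * ‖x‖ ^ (-((d : ℝ) + κ)) : ℝ) : ℂ) *
        oscIntegral κ (‖x‖⁻¹ • x) ν (fun r => exp (-(‖x‖ ^ (-α) * r ^ α))) := by
    rw [pairing_fracGradKernel hd hα0 (by linarith), integral_oscIntegrand_exp_neg_rpow κ α hxne,
      hfr]
    push_cast
    ring
  simp only [Pi.sub_apply]
  rw [hg, hf, ← mul_sub, norm_mul, norm_mul, norm_mul Complex.I, Complex.norm_I, one_mul,
    Complex.norm_real (_ * M), Real.norm_eq_abs (_ * M), abs_mul _ M]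
  calc _ ≤ ‖((1 / (2 * π) ^ d * ‖x‖ ^ (-((d : ℝ) + κ)) : ℝ) : ℂ)‖ *
        (|⟪‖x‖⁻¹ • x, ν⟫_ℝ| * (ε * |M|)) := by gcongr
    _ = _ := by ring
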